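/- Let $A_1,\dots,A_n$ be parties with nonzero finite-dimensional complex Hilbert spaces $\mathcal H_{A_1},\dots,\mathcal H_{A_n}$. For each $i$ let $X_{A_i}=\{X_{A_i}^k\}_k$ and $Y_{A_i}=\{Y_{A_i}^l\}_l$ be projective measurements on $\mathcal H_{A_i}$ (finite families of mutually orthogonal projections summing to the identity). Let $X_{A_1\cdots A_n}=\{X_{A_1}^{k_1}\otimes\cdots\otimes X_{A_n}^{k_n}\}_{k_1,\dots,k_n}$ and $Y_{A_1\cdots A_n}=\{Y_{A_1}^{l_1}\otimes\cdots\otimes Y_{A_n}^{l_n}\}_{l_1,\dots,l_n}$ be the global product measurements on $\mathcal H_{A_1}\otimes\cdots\otimes\mathcal H_{A_n}$. For a measurement $X=\{X^k\}$ and a state (density matrix) $\rho$ let $H(X|\rho)=-\sum_k p_k\log_2 p_k$ with $p_k=\operatorname{tr}(\rho X^k)$ be the Shannon entropy of the outcome distribution. For fixed weights $\lambda,\mu\ge 0$ let $$c_{A_i}(\lambda,\mu)=\inf_{\rho}\bigl(\lambda H(X_{A_i}|\rho)+\mu H(Y_{A_i}|\rho)\bigr),$$ $$c_{A_1\cdots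 A_n}(\lambda,\mu)=\inf_{\rho}\bigl(\lambda H(X_{A_1\cdots A_n}|\rho)+\mu H(Y_{A_1\cdots A_n}|\rho)\bigr)$$ be the optimal state-independent bounds, where the infima run over all states on $\mathcal H_{A_i}$ and over all (possibly entangled) states on $\mathcal H_{A_1}\otimes\cdots\otimes\mathcal H_{A_n}$, respectively. Then $$c_{A_1\cdots A_n}(\lambda,\mu)=\sum_{i=1}^n c_{A_i}(\lambda,\mu).$$ -/

import Mathlib

open scoped ComplexOrder

/-- A quantum state (density matrix) on the Hilbert space `ℂ^ι`. -/
structure DensityMatrix (ι : Type*) [Fintype ι] where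
  toMatrix : Matrix ι ι ℂ
  posSemidef : toMatrix.PosSemidef
  trace_eq_one : toMatrix.trace = 1

/-- A projective measurement on `ℂ^ι` with outcomes in `κ`: a family of mutually orthogonal
orthogonal projections that sum to the identity. -/
structure ProjectiveMeasurement (ι κ : Type*) [Fintype ι] [DecidableEq ι] [Fintype κ] where
  proj : κ → Matrix ι ι ℂ
  isHermitian : ∀ k, (proj k).IsHermitian
  idempotent : ∀ k, proj k * proj k = proj k
  orthogonal : ∀ k l, k ≠ l → proj k * proj l = 0
  sum_eq_one : ∑ k, proj k = 1

/-- The tensor product `M₁ ⊗ ⋯ ⊗ Mₙ` of matrices `Mₐ` on `ℂ^(ι a)`, acting on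
`⨂ₐ ℂ^(ι a) = ℂ^(Πₐ ι a)` (the Kronecker product of the family). -/
def tensorMatrix {P : Type*} [Fintype P] {ι : P → Type*}
    (M : ∀ a, Matrix (ι a) (ι a) ℂ) : Matrix (∀ a, ι a) (∀ a, ι a) ℂ :=
  Matrix.of fun x y => ∏ a, M a (x a) (y a)

theorem tensorMatrix_mul {P : Type*} [Fintype P] [DecidableEq P] {ι : P → Type*}
    [∀ a, Fintype (ι a)] (M N : ∀ a, Matrix (ι a) (ι a) ℂ) :
    tensorMatrix M * tensorMatrix N = tensorMatrix fun a => M a * N a := by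
  ext x y
  simp only [tensorMatrix, Matrix.mul_apply, Matrix.of_apply, ← Finset.prod_mul_distrib]
  rw [Finset.prod_univ_sum, Fintype.piFinset_univ]

/-- The product measurement: party `a` performs the local measurement `X a`, and the tuple of all
local outcomes is the outcome. The projections are the tensor products of the local ones. -/
def productMeasurement {P : Type*} [Fintype P] [DecidableEq P] {ι κ : P → Type*}
    [∀ a, Fintype (ι a)] [∀ a, DecidableEq (ι a)] [∀ a, Fintype (κ a)]
    (X : ∀ a, ProjectiveMeasurement (ι a) (κ a)) :
    ProjectiveMeasurement (∀ a, ι a) (∀ a, κ a) where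
  proj k := tensorMatrix fun a => (X a).proj (k a)
  isHermitian k := by
    ext x y
    simp only [tensorMatrix, Matrix.conjTranspose_apply, Matrix.of_apply, star_prod]
    exact Finset.prod_congr rfl fun a _ => ((X a).isHermitian (k a)).apply _ _
  idempotent k := by
    rw [tensorMatrix_mul]
    congr 1
    funext a
    exact (X a).idempotent _
  orthogonal k l h := by
    obtain ⟨a, ha⟩ := Function.ne_iff.mp h
    rw [tensorMatrix_mul]
    ext x y
    simp only [tensorMatrix, Matrix.of_apply, Matrix.zero_apply]
    refine Finset.prod_eq_zero (Finset.mem_univ a) ?_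
    rw [(X a).orthogonal _ _ ha, Matrix.zero_apply]
  sum_eq_one := by
    ext x y
    simp only [tensorMatrix, Matrix.sum_apply, Matrix.of_apply]
    have h : ∀ a, ∑ k, (X a).proj k (x a) (y a) = (1 : Matrix (ι a) (ι a) ℂ) (x a) (y a) := by
      intro a
      rw [← (X a).sum_eq_one, Matrix.sum_apply]
    have e := Finset.prod_univ_sum (fun a => (Finset.univ : Finset (κ a)))
      (fun a k => (X a).proj k (x a) (y a))
    rw [Fintype.piFinset_univ] at e
    rw [← e]
    simp only [h]
    by_cases hxy : x = y
    · subst hxy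
      simp
    · obtain ⟨a, ha⟩ := Function.ne_iff.mp hxy
      rw [Matrix.one_apply_ne hxy]
      exact Finset.prod_eq_zero (Finset.mem_univ a) (Matrix.one_apply_ne ha)

section

variable {ι κ κ' : Type*} [Fintype ι] [DecidableEq ι] [Fintype κ] [Fintype κ']

/-- The probability `tr (ρ X_k)` of the outcome `k`. -/
noncomputable def outcomeProb (X : ProjectiveMeasurement ι κ) (ρ : DensityMatrix ι) (k : κ) : ℝ :=
  (ρ.toMatrix * X.proj k).trace.re

/-- The Shannon entropy `H(X|ρ) = -∑ₖ pₖ log₂ pₖ` of the outcome distribution (`0 log 0 = 0`). -/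
noncomputable def measurementEntropy (X : ProjectiveMeasurement ι κ) (ρ : DensityMatrix ι) : ℝ :=
  -∑ k, outcomeProb X ρ k * Real.logb 2 (outcomeProb X ρ k)

/-- `c` is a state-independent lower bound: `s H(X|ρ) + t H(Y|ρ) ≥ c` on all states `ρ`. -/
def IsUncertaintyBound (s t : ℝ) (X : ProjectiveMeasurement ι κ)
    (Y : ProjectiveMeasurement ι κ') (c : ℝ) : Prop :=
  ∀ ρ : DensityMatrix ι, c ≤ s * measurementEntropy X ρ + t * measurementEntropy Y ρ

/-- The optimal bound `c(s, t) = inf_ρ (s H(X|ρ) + t H(Y|ρ))`. -/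
noncomputable def optimalBound (s t : ℝ) (X : ProjectiveMeasurement ι κ)
    (Y : ProjectiveMeasurement ι κ') : ℝ :=
  ⨅ ρ : DensityMatrix ι, (s * measurementEntropy X ρ + t * measurementEntropy Y ρ)

theorem outcomeProb_nonneg (X : ProjectiveMeasurement ι κ) (ρ : DensityMatrix ι) (k : κ) :
    0 ≤ outcomeProb X ρ k := by
  have h := (ρ.posSemidef.mul_mul_conjTranspose_same (X.proj k)).trace_nonneg
  rw [(X.isHermitian k).eq, Matrix.trace_mul_comm, ← Matrix.mul_assoc, X.idempotent,
    Matrix.trace_mul_comm] at h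
  exact (Complex.le_def.mp h).1

theorem sum_outcomeProb (X : ProjectiveMeasurement ι κ) (ρ : DensityMatrix ι) :
    ∑ k, outcomeProb X ρ k = 1 := by
  simp only [outcomeProb]
  rw [← Complex.re_sum, ← Matrix.trace_sum, ← Matrix.mul_sum, X.sum_eq_one, Matrix.mul_one,
    ρ.trace_eq_one, Complex.one_re]

theorem measurementEntropy_nonneg (X : ProjectiveMeasurement ι κ) (ρ : DensityMatrix ι) :
    0 ≤ measurementEntropy X ρ := by
  rw [measurementEntropy, ← Finset.sum_neg_distrib]
  refine Finset.sum_nonneg fun k _ => ?_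
  have h0 := outcomeProb_nonneg X ρ k
  have h1 : outcomeProb X ρ k ≤ 1 := by
    rw [← sum_outcomeProb X ρ]
    exact Finset.single_le_sum (fun l _ => outcomeProb_nonneg X ρ l) (Finset.mem_univ k)
  have h2 : Real.logb 2 (outcomeProb X ρ k) ≤ 0 := Real.logb_nonpos (by norm_num) h0 h1
  nlinarith

instance DensityMatrix.instNonempty [Nonempty ι] : Nonempty (DensityMatrix ι) := by
  obtain ⟨i⟩ := ‹Nonempty ι›
  refine ⟨⟨Matrix.diagonal (Pi.single i 1), Matrix.PosSemidef.diagonal ?_, ?_⟩⟩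
  · intro j
    by_cases h : j = i
    · subst h
      simp
    · simp [h]
  · simp [Matrix.trace_diagonal]

/-- The infimum is a genuine one: `optimalBound` is the best (greatest) state-independent bound. -/
theorem optimalBound_isGreatest [Nonempty ι] {s t : ℝ} (hs : 0 ≤ s) (ht : 0 ≤ t)
    (X : ProjectiveMeasurement ι κ) (Y : ProjectiveMeasurement ι κ') :
    IsGreatest {c | IsUncertaintyBound s t X Y c} (optimalBound s t X Y) := by
  refine ⟨fun ρ => ciInf_le ⟨0, ?_⟩ ρ, fun c hc => le_ciInf hc⟩
  rintro _ ⟨σ, rfl⟩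
  exact add_nonneg (mul_nonneg hs (measurementEntropy_nonneg X σ))
    (mul_nonneg ht (measurementEntropy_nonneg Y σ))

end

/-! Splitting off the first party and inducting on `n` reduces the claim to two parties A and B. For
`≤`, entropies add on product states. For `≥`, take any state on A ⊗ B and expand the two global
entropies in opposite orders: H(X₁) + H(X₂|X₁) and H(Y₂) + H(Y₁|Y₂). Let σₖ be the state of B after
outcome k of X₁ (probability wₖ), and τₗ the state of A after outcome l of Y₂ (probability vₗ). Then
H(X₂|X₁) = ∑ wₖ H(X₂|σₖ) and H(Y₁|Y₂) = ∑ vₗ H(Y₁|τₗ). Conditioning on the other party's outcome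
also gives H(Y₂) ≥ ∑ wₖ H(Y₂|σₖ) and H(X₁) ≥ ∑ vₗ H(X₁|τₗ). Thanks to the crossed orders, X₂ and Y₂
are evaluated on the same states σₖ, and X₁ and Y₁ on the same τₗ. So the local bounds apply state
by state and are then averaged, entangled or not. -/

open scoped Kronecker in
/-- The product of two measurements, with projections `Xᵏ ⊗ Yˡ`. -/
def ProjectiveMeasurement.kronecker {α β κ κ' : Type*} [Fintype α] [DecidableEq α] [Fintype β]
    [DecidableEq β] [Fintype κ] [Fintype κ']
    (X : ProjectiveMeasurement α κ) (Y : ProjectiveMeasurement β κ') :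
    ProjectiveMeasurement (α × β) (κ × κ') where
  proj k := X.proj k.1 ⊗ₖ Y.proj k.2
  isHermitian k := by
    rw [Matrix.IsHermitian, Matrix.conjTranspose_kronecker, (X.isHermitian _).eq,
      (Y.isHermitian _).eq]
  idempotent k := by rw [← Matrix.mul_kronecker_mul, X.idempotent, Y.idempotent]
  orthogonal k l h := by
    rw [← Matrix.mul_kronecker_mul]
    by_cases h1 : k.1 = l.1
    · rw [Y.orthogonal _ _ fun h2 => h (Prod.ext h1 h2), Matrix.kronecker_zero]
    · rw [X.orthogonal _ _ h1, Matrix.zero_kronecker]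
  sum_eq_one := by
    ext x y
    have hX : ∀ i j, ∑ k, X.proj k i j = (1 : Matrix α α ℂ) i j := fun i j => by
      rw [← X.sum_eq_one, Matrix.sum_apply]
    have hY : ∀ i j, ∑ k, Y.proj k i j = (1 : Matrix β β ℂ) i j := fun i j => by
      rw [← Y.sum_eq_one, Matrix.sum_apply]
    rw [← Matrix.one_kronecker_one]
    simp only [Matrix.sum_apply, Matrix.kroneckerMap_apply, Fintype.sum_prod_type,
      ← Finset.mul_sum, ← Finset.sum_mul, hX, hY]

/-! ### States: relabelling, products, conditioning -/

namespace DensityMatrix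

/-- Transport of states along a relabelling of the basis. -/
def reindex {ι ι' : Type*} [Fintype ι] [Fintype ι'] (e : ι ≃ ι') :
    DensityMatrix ι ≃ DensityMatrix ι' where
  toFun ρ := ⟨ρ.toMatrix.submatrix e.symm e.symm, ρ.posSemidef.submatrix _, by
    rw [← ρ.trace_eq_one]
    exact e.symm.sum_comp fun i => ρ.toMatrix i i⟩
  invFun ρ := ⟨ρ.toMatrix.submatrix e e, ρ.posSemidef.submatrix _, by
    rw [← ρ.trace_eq_one]
    exact e.sum_comp fun i => ρ.toMatrix i i⟩
  left_inv ρ := by cases ρ; simp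
  right_inv ρ := by cases ρ; simp

theorem trace_reindex_mul {ι ι' : Type*} [Fintype ι] [Fintype ι'] (e : ι ≃ ι')
    (ρ : DensityMatrix ι) (M : Matrix ι' ι' ℂ) :
    ((reindex e ρ).toMatrix * M).trace = (ρ.toMatrix * M.submatrix e e).trace := by
  have h : (reindex e ρ).toMatrix * M =
      (ρ.toMatrix * M.submatrix e e).submatrix e.symm e.symm := by
    rw [← Matrix.submatrix_mul_equiv _ _ _ e.symm]
    simp [reindex]
  rw [h]
  exact e.symm.sum_comp fun i => (ρ.toMatrix * M.submatrix e e) i i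

variable {α β : Type*} [Fintype α] [DecidableEq α] [Fintype β] [DecidableEq β]

open scoped Kronecker

/-- The product state `ρ ⊗ σ`. -/
noncomputable def kronecker (ρ : DensityMatrix α) (σ : DensityMatrix β) :
    DensityMatrix (α × β) where
  toMatrix := ρ.toMatrix ⊗ₖ σ.toMatrix
  posSemidef := ρ.posSemidef.kronecker σ.posSemidef
  trace_eq_one := by rw [Matrix.trace_kronecker, ρ.trace_eq_one, σ.trace_eq_one, mul_one]

/-- The state of the second system after the outcome `E` was found on the first one, together with
the probability `w` of that outcome. -/
theorem exists_conditional_right [Nonempty β] (ρ : DensityMatrix (α × β)) (E : Matrix α α ℂ)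
    (hE : E.IsHermitian) (hEE : E * E = E) :
    ∃ (w : ℝ) (σ : DensityMatrix β), 0 ≤ w ∧
      ∀ M, (ρ.toMatrix * (E ⊗ₖ M)).trace = (w : ℂ) * (σ.toMatrix * M).trace := by
  -- The unnormalised conditional state `T` is the partial trace over the first system of `F ρ F`;
  -- sandwiching by the projection `F` makes positivity visible.
  let F : Matrix (α × β) (α × β) ℂ := E ⊗ₖ (1 : Matrix β β ℂ)
  have hF : F.conjTranspose = F := by
    simp only [F, Matrix.conjTranspose_kronecker, hE.eq, Matrix.conjTranspose_one]
  let N := F * ρ.toMatrix * F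
  have hN : N.PosSemidef := by
    have := ρ.posSemidef.mul_mul_conjTranspose_same F
    rwa [hF] at this
  let T : Matrix β β ℂ := ∑ a, N.submatrix (Prod.mk a) (Prod.mk a)
  have hT : T.PosSemidef := Matrix.posSemidef_sum _ fun a _ => hN.submatrix _
  have key : ∀ M, (ρ.toMatrix * (E ⊗ₖ M)).trace = (T * M).trace := by
    intro M
    have h1 : E ⊗ₖ M = F * ((1 : Matrix α α ℂ) ⊗ₖ M) * F := by
      simp only [F, ← Matrix.mul_kronecker_mul, Matrix.mul_one, Matrix.one_mul, hEE]
    have h2 : (ρ.toMatrix * (E ⊗ₖ M)).trace = (N * ((1 : Matrix α α ℂ) ⊗ₖ M)).trace := by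
      rw [h1, ← Matrix.mul_assoc, Matrix.trace_mul_comm]
      simp only [N, Matrix.mul_assoc]
    rw [h2]
    simp only [Matrix.trace, Matrix.diag, Matrix.mul_apply, Fintype.sum_prod_type,
      Matrix.kroneckerMap_apply, Matrix.one_apply, ite_mul, one_mul, zero_mul, mul_ite, mul_zero,
      T, Matrix.sum_apply, Matrix.submatrix_apply, Finset.sum_mul]
    rw [Finset.sum_comm]
    refine Finset.sum_congr rfl fun b _ => ?_
    rw [Finset.sum_comm]
    conv_rhs => rw [Finset.sum_comm]
    rw [Finset.sum_comm]
    refine Finset.sum_congr rfl fun a _ => ?_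
    rw [Finset.sum_comm]
    refine Finset.sum_congr rfl fun c _ => ?_
    simp
  have h0 := hT.trace_nonneg
  have hre : T.trace = (T.trace.re : ℂ) := by
    apply Complex.ext
    · simp
    · simpa using (Complex.le_def.mp h0).2.symm
  by_cases hz : T.trace = 0
  -- An outcome of probability zero has no conditional state; the weight 0 makes any choice work.
  · refine ⟨0, Classical.arbitrary _, le_rfl, fun M => ?_⟩
    rw [key, hT.trace_eq_zero_iff.mp hz]
    simp
  · refine ⟨T.trace.re, ⟨T.trace⁻¹ • T, hT.smul (inv_nonneg.mpr h0), ?_⟩,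
      (Complex.le_def.mp h0).1, fun M => ?_⟩
    · rw [Matrix.trace_smul, smul_eq_mul, inv_mul_cancel₀ hz]
    · rw [key, ← hre, Matrix.smul_mul, Matrix.trace_smul, smul_eq_mul, mul_inv_cancel_left₀ hz]

/-- Follows from the mirror statement by swapping the tensor factors. -/
theorem exists_conditional_left [Nonempty α] (ρ : DensityMatrix (α × β)) (E : Matrix β β ℂ)
    (hE : E.IsHermitian) (hEE : E * E = E) :
    ∃ (w : ℝ) (σ : DensityMatrix α), 0 ≤ w ∧
      ∀ M, (ρ.toMatrix * (M ⊗ₖ E)).trace = (w : ℂ) * (σ.toMatrix * M).trace := by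
  obtain ⟨w, σ, hw, h⟩ := exists_conditional_right (reindex (Equiv.prodComm α β) ρ) E hE hEE
  refine ⟨w, σ, hw, fun M => ?_⟩
  rw [← h, trace_reindex_mul]
  congr 2
  ext x y
  simp [mul_comm]

end DensityMatrix

/-! ### Entropy and optimal bounds under relabelling -/

section

variable {ι κ κ' : Type*} [Fintype ι] [DecidableEq ι] [Fintype κ] [Fintype κ']

theorem measurementEntropy_eq_sum_negMulLog (X : ProjectiveMeasurement ι κ)
    (ρ : DensityMatrix ι) :
    measurementEntropy X ρ = (∑ k, Real.negMulLog (outcomeProb X ρ k)) / Real.log 2 := by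
  rw [measurementEntropy, ← Finset.sum_neg_distrib, Finset.sum_div]
  refine Finset.sum_congr rfl fun k _ => ?_
  rw [Real.negMulLog, Real.logb]
  ring

theorem optimalBound_le {s t : ℝ} [Nonempty ι] (hs : 0 ≤ s) (ht : 0 ≤ t)
    (X : ProjectiveMeasurement ι κ) (Y : ProjectiveMeasurement ι κ') (ρ : DensityMatrix ι) :
    optimalBound s t X Y ≤ s * measurementEntropy X ρ + t * measurementEntropy Y ρ :=
  (optimalBound_isGreatest hs ht X Y).1 ρ

theorem measurementEntropy_reindex {ι₁ κ₁ : Type*} [Fintype ι₁] [DecidableEq ι₁] [Fintype κ₁]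
    (e : ι ≃ ι₁) (f : κ ≃ κ₁) (X : ProjectiveMeasurement ι κ) (X₁ : ProjectiveMeasurement ι₁ κ₁)
    (h : ∀ k, (X₁.proj (f k)).submatrix e e = X.proj k) (ρ : DensityMatrix ι) :
    measurementEntropy X₁ (DensityMatrix.reindex e ρ) = measurementEntropy X ρ := by
  rw [measurementEntropy, measurementEntropy, ← f.sum_comp]
  simp only [outcomeProb, DensityMatrix.trace_reindex_mul, h]

theorem optimalBound_reindex {ι₁ κ₁ κ₁' : Type*} [Fintype ι₁] [DecidableEq ι₁] [Fintype κ₁]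
    [Fintype κ₁'] (s t : ℝ) (e : ι ≃ ι₁) (f : κ ≃ κ₁) (g : κ' ≃ κ₁')
    (X : ProjectiveMeasurement ι κ) (X₁ : ProjectiveMeasurement ι₁ κ₁)
    (Y : ProjectiveMeasurement ι κ') (Y₁ : ProjectiveMeasurement ι₁ κ₁')
    (hX : ∀ k, (X₁.proj (f k)).submatrix e e = X.proj k)
    (hY : ∀ k, (Y₁.proj (g k)).submatrix e e = Y.proj k) :
    optimalBound s t X₁ Y₁ = optimalBound s t X Y := by
  refine (Equiv.iInf_congr (DensityMatrix.reindex e) fun ρ => ?_).symm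
  rw [measurementEntropy_reindex e f X X₁ hX, measurementEntropy_reindex e g Y Y₁ hY]

theorem measurementEntropy_eq_zero_of_unique [Unique κ] (X : ProjectiveMeasurement ι κ)
    (ρ : DensityMatrix ι) : measurementEntropy X ρ = 0 := by
  have h := sum_outcomeProb X ρ
  rw [Fintype.sum_unique] at h
  rw [measurementEntropy, Fintype.sum_unique, h]
  simp

end

/-! ### Chain rule, concavity and product states -/

section

variable {α β κ κ' : Type*} [Fintype α] [DecidableEq α] [Fintype β] [DecidableEq β]
  [Fintype κ] [Fintype κ']

/-- Chain rule: joint entropy is that of the first variable plus the average conditional entropy of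
the second. -/
theorem sum_negMulLog_mul {κ κ' : Type*} [Fintype κ] [Fintype κ'] (w : κ → ℝ)
    (p : κ → κ' → ℝ) (hp : ∀ k, ∑ l, p k l = 1) :
    ∑ k, ∑ l, Real.negMulLog (w k * p k l) =
      ∑ k, Real.negMulLog (w k) + ∑ k, w k * ∑ l, Real.negMulLog (p k l) := by
  simp only [Real.negMulLog_mul, Finset.sum_add_distrib, ← Finset.sum_mul, ← Finset.mul_sum, hp,
    one_mul]

/-- Conditioning reduces entropy. -/
theorem sum_mul_sum_negMulLog_le {κ κ' : Type*} [Fintype κ] [Fintype κ'] (w : κ → ℝ)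
    (p : κ → κ' → ℝ) (hw : ∀ k, 0 ≤ w k) (hw1 : ∑ k, w k = 1) (hp : ∀ k l, 0 ≤ p k l) :
    ∑ k, w k * ∑ l, Real.negMulLog (p k l) ≤ ∑ l, Real.negMulLog (∑ k, w k * p k l) := by
  simp only [Finset.mul_sum]
  rw [Finset.sum_comm]
  refine Finset.sum_le_sum fun l _ => ?_
  simpa only [smul_eq_mul] using Real.concaveOn_negMulLog.le_map_sum (t := Finset.univ) (w := w)
    (p := fun k => p k l) (fun k _ => hw k) hw1 fun k _ => hp k l

/-- The entropies of a product state add up. -/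
theorem measurementEntropy_kronecker (X : ProjectiveMeasurement α κ)
    (Y : ProjectiveMeasurement β κ') (ρ : DensityMatrix α) (σ : DensityMatrix β) :
    measurementEntropy (X.kronecker Y) (ρ.kronecker σ) =
      measurementEntropy X ρ + measurementEntropy Y σ := by
  have h : ∀ k l, outcomeProb (X.kronecker Y) (ρ.kronecker σ) (k, l) =
      outcomeProb X ρ k * outcomeProb Y σ l := by
    intro k l
    -- The real part of a product of traces factors once one of them is real.
    have hre : (ρ.toMatrix * X.proj k).trace.im = 0 := by
      have h := (ρ.posSemidef.mul_mul_conjTranspose_same (X.proj k)).trace_nonneg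
      rw [(X.isHermitian k).eq, Matrix.trace_mul_comm, ← Matrix.mul_assoc, X.idempotent,
        Matrix.trace_mul_comm] at h
      exact (Complex.le_def.mp h).2.symm
    simp only [outcomeProb, ProjectiveMeasurement.kronecker, DensityMatrix.kronecker,
      ← Matrix.mul_kronecker_mul, Matrix.trace_kronecker, Complex.mul_re, hre]
    ring
  simp only [measurementEntropy_eq_sum_negMulLog, Fintype.sum_prod_type, h]
  rw [sum_negMulLog_mul _ _ fun _ => sum_outcomeProb Y σ, ← Finset.sum_mul, sum_outcomeProb,
    one_mul, add_div]

end

/-! ### Additivity for two parties -/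

section

variable {α β κ₁ κ₁' κ₂ κ₂' : Type*} [Fintype α] [DecidableEq α] [Fintype β] [DecidableEq β]
  [Fintype κ₁] [Fintype κ₁'] [Fintype κ₂] [Fintype κ₂']

/-- Both entropies are expanded by the chain rule, the first one after the outcome of `X₁` and the
second one after the outcome of `Y₂`; the measurements `X₁` and `Y₂` are jointly performed. -/
theorem optimalBound_add_le [Nonempty α] [Nonempty β] {s t : ℝ} (hs : 0 ≤ s) (ht : 0 ≤ t)
    (X₁ : ProjectiveMeasurement α κ₁) (Y₁ : ProjectiveMeasurement α κ₁')
    (X₂ : ProjectiveMeasurement β κ₂) (Y₂ : ProjectiveMeasurement β κ₂')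
    (ρ : DensityMatrix (α × β)) :
    optimalBound s t X₁ Y₁ + optimalBound s t X₂ Y₂ ≤
      s * measurementEntropy (X₁.kronecker X₂) ρ + t * measurementEntropy (Y₁.kronecker Y₂) ρ := by
  choose w σ hw hσ using fun k =>
    ρ.exists_conditional_right (X₁.proj k) (X₁.isHermitian k) (X₁.idempotent k)
  choose v τ hv hτ using fun l =>
    ρ.exists_conditional_left (Y₂.proj l) (Y₂.isHermitian l) (Y₂.idempotent l)
  have hX : ∀ k l, outcomeProb (X₁.kronecker X₂) ρ (k, l) = w k * outcomeProb X₂ (σ k) l := by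
    intro k l
    simp only [outcomeProb, ProjectiveMeasurement.kronecker, hσ, Complex.re_ofReal_mul]
  have hY : ∀ k l, outcomeProb (Y₁.kronecker Y₂) ρ (k, l) = v l * outcomeProb Y₁ (τ l) k := by
    intro k l
    simp only [outcomeProb, ProjectiveMeasurement.kronecker, hτ, Complex.re_ofReal_mul]
  -- Both sides are the joint probability tr ρ(X₁ᵏ ⊗ Y₂ˡ), conditioned in either order.
  have hXY : ∀ k l, w k * outcomeProb Y₂ (σ k) l = v l * outcomeProb X₁ (τ l) k := by
    intro k l
    simp only [outcomeProb, ← Complex.re_ofReal_mul, ← hσ, ← hτ]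
  have hwv : ∀ k, w k = ∑ l, v l * outcomeProb X₁ (τ l) k := by
    intro k
    simp only [← hXY, ← Finset.mul_sum, sum_outcomeProb, mul_one]
  have hvw : ∀ l, v l = ∑ k, w k * outcomeProb Y₂ (σ k) l := by
    intro l
    simp only [hXY, ← Finset.mul_sum, sum_outcomeProb, mul_one]
  have hw1 : ∑ k, w k = 1 := by
    rw [← sum_outcomeProb (X₁.kronecker X₂) ρ, Fintype.sum_prod_type]
    simp only [hX, ← Finset.mul_sum, sum_outcomeProb, mul_one]
  have hv1 : ∑ l, v l = 1 := by
    rw [← sum_outcomeProb (Y₁.kronecker Y₂) ρ, Fintype.sum_prod_type_right]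
    simp only [hY, ← Finset.mul_sum, sum_outcomeProb, mul_one]
  have h2 : 0 < Real.log 2 := Real.log_pos one_lt_two
  -- The chain rule yields the second sum exactly; the first is bounded by concavity, as `w` is the
  -- `v`-mixture of the X₁-distributions of the `τ l`.
  have eX : ∑ l, v l * measurementEntropy X₁ (τ l) + ∑ k, w k * measurementEntropy X₂ (σ k) ≤
      measurementEntropy (X₁.kronecker X₂) ρ := by
    simp only [measurementEntropy_eq_sum_negMulLog, ← mul_div_assoc, ← Finset.sum_div, ← add_div,
      Fintype.sum_prod_type, hX]
    rw [sum_negMulLog_mul _ _ fun k => sum_outcomeProb X₂ (σ k)]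
    gcongr
    calc _ ≤ _ := sum_mul_sum_negMulLog_le v (fun l => outcomeProb X₁ (τ l)) hv hv1
            fun l => outcomeProb_nonneg X₁ (τ l)
      _ = _ := by simp only [← hwv]
  have eY : ∑ k, w k * measurementEntropy Y₂ (σ k) + ∑ l, v l * measurementEntropy Y₁ (τ l) ≤
      measurementEntropy (Y₁.kronecker Y₂) ρ := by
    simp only [measurementEntropy_eq_sum_negMulLog, ← mul_div_assoc, ← Finset.sum_div, ← add_div,
      Fintype.sum_prod_type_right, hY]
    rw [sum_negMulLog_mul _ _ fun l => sum_outcomeProb Y₁ (τ l)]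
    gcongr
    calc _ ≤ _ := sum_mul_sum_negMulLog_le w (fun k => outcomeProb Y₂ (σ k)) hw hw1
            fun k => outcomeProb_nonneg Y₂ (σ k)
      _ = _ := by simp only [← hvw]
  have c₁ : optimalBound s t X₁ Y₁ ≤
      ∑ l, v l * (s * measurementEntropy X₁ (τ l) + t * measurementEntropy Y₁ (τ l)) := by
    rw [← one_mul (optimalBound s t X₁ Y₁), ← hv1, Finset.sum_mul]
    exact Finset.sum_le_sum fun l _ =>
      mul_le_mul_of_nonneg_left (optimalBound_le hs ht X₁ Y₁ (τ l)) (hv l)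
  have c₂ : optimalBound s t X₂ Y₂ ≤
      ∑ k, w k * (s * measurementEntropy X₂ (σ k) + t * measurementEntropy Y₂ (σ k)) := by
    rw [← one_mul (optimalBound s t X₂ Y₂), ← hw1, Finset.sum_mul]
    exact Finset.sum_le_sum fun k _ =>
      mul_le_mul_of_nonneg_left (optimalBound_le hs ht X₂ Y₂ (σ k)) (hw k)
  simp only [mul_add, Finset.sum_add_distrib, mul_left_comm _ s, mul_left_comm _ t,
    ← Finset.mul_sum] at c₁ c₂
  have := mul_le_mul_of_nonneg_left eX hs
  have := mul_le_mul_of_nonneg_left eY ht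
  linarith

/-- Product states give `≤`; `optimalBound_add_le` gives `≥`. -/
theorem optimalBound_kronecker [Nonempty α] [Nonempty β] {s t : ℝ} (hs : 0 ≤ s) (ht : 0 ≤ t)
    (X₁ : ProjectiveMeasurement α κ₁) (Y₁ : ProjectiveMeasurement α κ₁')
    (X₂ : ProjectiveMeasurement β κ₂) (Y₂ : ProjectiveMeasurement β κ₂') :
    optimalBound s t (X₁.kronecker X₂) (Y₁.kronecker Y₂) =
      optimalBound s t X₁ Y₁ + optimalBound s t X₂ Y₂ := by
  refine le_antisymm (le_ciInf_add_ciInf fun ρ σ => ?_)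
    (le_ciInf (optimalBound_add_le hs ht X₁ Y₁ X₂ Y₂))
  refine (optimalBound_le hs ht _ _ (ρ.kronecker σ)).trans_eq ?_
  rw [measurementEntropy_kronecker, measurementEntropy_kronecker]
  ring

end

/-! ### Induction on the number of parties -/

/-- A product measurement on `n + 1` parties is the product of the measurement of the first party
with the product measurement on the others. -/
theorem productMeasurement_proj_cons {n : ℕ} {ι κ : Fin (n + 1) → Type*}
    [∀ a, Fintype (ι a)] [∀ a, DecidableEq (ι a)] [∀ a, Fintype (κ a)]
    (X : ∀ a, ProjectiveMeasurement (ι a) (κ a)) (k : κ 0 × ∀ a : Fin n, κ a.succ) :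
    ((productMeasurement X).proj (Fin.consEquiv κ k)).submatrix (Fin.consEquiv ι)
        (Fin.consEquiv ι) =
      ((X 0).kronecker (productMeasurement fun a : Fin n => X a.succ)).proj k := by
  ext x y
  simp [productMeasurement, tensorMatrix, ProjectiveMeasurement.kronecker, Fin.consEquiv,
    Fin.prod_univ_succ]

theorem mainTheorem6 (n : ℕ) (ι κ κ' : Fin n → Type*)
    [∀ a, Fintype (ι a)] [∀ a, DecidableEq (ι a)] [∀ a, Nonempty (ι a)]
    [∀ a, Fintype (κ a)] [∀ a, Fintype (κ' a)]
    (X : ∀ a, ProjectiveMeasurement (ι a) (κ a))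
    (Y : ∀ a, ProjectiveMeasurement (ι a) (κ' a))
    (s t : ℝ) (hs : 0 ≤ s) (ht : 0 ≤ t) :
    optimalBound s t (productMeasurement X) (productMeasurement Y) =
      ∑ a, optimalBound s t (X a) (Y a) := by
  induction n with
  -- With no parties the only outcome is the empty tuple, so all entropies vanish.
  | zero => simp [optimalBound, measurementEntropy_eq_zero_of_unique]
  | succ n ih =>
    rw [Fin.sum_univ_succ, ← ih, ← optimalBound_kronecker hs ht]
    exact optimalBound_reindex s t (Fin.consEquiv ι) (Fin.consEquiv κ) (Fin.consEquiv κ') _ _ _ _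
      (productMeasurement_proj_cons X) (productMeasurement_proj_cons Y)
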